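/- \textbf{Networks and codes.} A network is a finite acyclic directed graph with source nodes, intermediate nodes and receiver nodes; each receiver $t$ demands the message of one source $\tau(t)$, and every source is demanded. For a field $\mathbb F$ and $k,l\ge 1$, a $(k,l)$-linear solution over $\mathbb F$ assigns to each intermediate node an $\mathbb F$-linear map, from the messages carried by its in-neighbours to $\mathbb F^l$, and to each receiver an $\mathbb F$-linear decoding map from the messages carried by its in-neighbours to $\mathbb F^k$, such that, whatever messages in $\mathbb F^k$ the sources carry, each receiver $t$ recovers the message of $\tau(t)$. The network is linearly solvable over $\mathbb F$ if it has a $(k,k)$-linear solution over $\mathbb F$ for some $k\ge 1$, and its linear capacity $\mathrm C^{\mathbb F}_{\mathrm{linear}}$ is the supremum of $k/l$ over all $(k,l)$-linear solutions over $\mathbb F$. \textbf{Index coding.} An index coding network $\mathcal N=(S,E^*)$ consists of a finite set $S$ of sources and a set $E^*$ of pairs $(s,Y)$ with $s\in S$, $Y\subseteq S$, every $s\in S$ being the first component of some pair; the pair $(s,Y)$ is a receiver that demands $s$ and knows the messages of $Y$. For $m\ge 1$, $\mathcal N[m]$ is the network with sources $S$, $m$ intermediate nodes, each joined by an edge from every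 source and by an edge to every receiver, receivers $(s,Y)\in E^*$, and edges from each $y\in Y$ to the receiver $(s,Y)$. The lexicographic product $\mathcal N_1\bullet\mathcal N_2$ has source set $S_1\times S_2$ and receivers $\big((s_1,s_2),\,(Y_1\times S_2)\cup(\{s_1\}\times Y_2)\big)$ for $(s_1,Y_1)\in E_1^*$, $(s_2,Y_2)\in E_2^*$; $\mathcal N^{\bullet k}$ is the $k$-fold power, $k\ge1$. For $n\ge 2$ let $S=\{A_1,\dots,A_{n+1},B_1,\dots,B_{n+1},C\}$. Let $\mathcal A_n$ consist of the sets $\{A_1,\dots,A_{n+1},C\}$, $\{A_j:j\ne i\}\cup\{B_i\}$ and $\{A_i,B_i,C\}$ for $1\le i\le n+1$, and $\{B_1,\dots,B_{n+1}\}$. Let $\mathcal B_n$ be the same collection with $\{B_1,\dots,B_{n+1}\}$ replaced by $\{B_1,\dots,B_{n+1},C\}$. Let $\mathcal N_{\mathcal A_n}$ and $\mathcal N_{\mathcal B_n}$ be the index coding networks with source set $S$ and receivers $(s,Y\setminus\{s\})$ for $s\in Y\in\mathcal A_n$, respectively $s\in Y\in\mathcal B_n$. \textbf{Theorem.} Let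 $n\ge 2$ and $k\ge 1$ be integers and let $\mathbb F$ be a field. (i) $\mathcal N_{\mathcal A_n}^{\bullet k}[(n+2)^k]$ is linearly solvable over $\mathbb F$ if and only if $\operatorname{char}\mathbb F$ divides $n$. If $\operatorname{char}\mathbb F\nmid n$, then $$\Big(\frac{n+2}{n+3}\Big)^k\le \mathrm C^{\mathbb F}_{\mathrm{linear}}\big(\mathcal N_{\mathcal A_n}^{\bullet k}[(n+2)^k]\big)\le\Big(\frac{5n^3+22n^2+31n+14}{5n^3+22n^2+31n+15}\Big)^k .$$ (ii) $\mathcal N_{\mathcal B_n}^{\bullet k}[(n+2)^k]$ is linearly solvable over $\mathbb F$ if and only if $\operatorname{char}\mathbb F$ does not divide $n$. If $\operatorname{char}\mathbb F\mid n$, then $$\Big(\frac{n+2}{n+3}\Big)^k\le \mathrm C^{\mathbb F}_{\mathrm{linear}}\big(\mathcal N_{\mathcal B_n}^{\bullet k}[(n+2)^k]\big)\le\Big(\frac{n^3+8n^2+19n+14}{n^3+8n^2+19n+15}\Big)^k .$$ (Characteristic $0$ divides no $n\ge 2$.) -/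

import Mathlib

open scoped ENNReal

/-- A network in circuit representation: a finite acyclic directed graph whose nodes are sources,
receivers and intermediate (`Inner`) nodes, and a demand function from the receivers onto the
sources. Sources have no incoming edges and receivers have no outgoing edges. A node sends the same
message along all of its outgoing edges, so parallel edges play no role and the edges form a
relation. -/
structure Network where
  Source : Type
  Inner : Type
  Receiver : Type
  finite_source : Finite Source
  finite_inner : Finite Inner
  finite_receiver : Finite Receiver
  edge : Source ⊕ Inner → Inner ⊕ Receiver → Prop
  acyclic : ∀ v : Inner, ¬ Relation.TransGen (fun w u => edge (Sum.inr w) (Sum.inl u)) v v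
  demand : Receiver → Source
  demand_surjective : Function.Surjective demand

namespace Network

/-- The tuples of messages that may arrive at the node `v`, when sources carry elements of `𝔸 ^ k`
and intermediate nodes carry elements of `𝔸 ^ l`. -/
abbrev Inputs (N : Network) (𝔸 : Type*) (k l : ℕ) (v : N.Inner ⊕ N.Receiver) : Type _ :=
  ({s : N.Source // N.edge (Sum.inl s) v} → Fin k → 𝔸) ×
    ({w : N.Inner // N.edge (Sum.inr w) v} → Fin l → 𝔸)

/-- The input of the node `v` when the sources carry `x` and the intermediate nodes carry `y`. -/
def inputs (N : Network) {𝔸 : Type*} {k l : ℕ} (v : N.Inner ⊕ N.Receiver)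
    (x : N.Source → Fin k → 𝔸) (y : N.Inner → Fin l → 𝔸) : N.Inputs 𝔸 k l v :=
  (fun s => x s.1, fun w => y w.1)

/-- A `(k, l)`-network code over the alphabet `𝔸`: a coding function for every intermediate node
and a decoding function for every receiver (the functions at the sources are identities). -/
structure Code (N : Network) (𝔸 : Type*) (k l : ℕ) where
  enc : ∀ v : N.Inner, N.Inputs 𝔸 k l (Sum.inl v) → Fin l → 𝔸
  dec : ∀ t : N.Receiver, N.Inputs 𝔸 k l (Sum.inr t) → Fin k → 𝔸

/-- A code over a field is linear if all of its functions are linear. -/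
def Code.IsLinear {N : Network} {F : Type*} [Field F] {k l : ℕ} (c : N.Code F k l) : Prop :=
  (∀ v, IsLinearMap F (c.enc v)) ∧ ∀ t, IsLinearMap F (c.dec t)

/-- A code is a solution if every receiver decodes the message it demands, for all tuples of
messages `x`. Here `y x v` is the message carried by the intermediate node `v` when the sources
carry `x`; as the network is finite and acyclic, `y` is determined by the code. -/
def Code.IsSolution {N : Network} {𝔸 : Type*} {k l : ℕ} (c : N.Code 𝔸 k l) : Prop :=
  ∃ y : (N.Source → Fin k → 𝔸) → N.Inner → Fin l → 𝔸,
    (∀ x v, y x v = c.enc v (N.inputs (Sum.inl v) x (y x))) ∧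
    ∀ x t, c.dec t (N.inputs (Sum.inr t) x (y x)) = x (N.demand t)

/-- `N` has a `(k, l)`-linear solution over `F`. -/
def HasLinearSolution (N : Network) (F : Type*) [Field F] (k l : ℕ) : Prop :=
  ∃ c : N.Code F k l, c.IsLinear ∧ c.IsSolution

/-- (Vector) linear solvability over `F`: there is a `(k, k)`-linear solution for some `k ≥ 1`. -/
def LinearlySolvable (N : Network) (F : Type*) [Field F] : Prop :=
  ∃ k : ℕ, 1 ≤ k ∧ N.HasLinearSolution F k k

/-- The linear capacity over `F`: the supremum of the rates `k / l` of `(k, l)`-linear solutions,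
with `k, l ≥ 1`. -/
noncomputable def linearCapacity (N : Network) (F : Type*) [Field F] : ℝ≥0∞ :=
  sSup {r | ∃ k l : ℕ, 1 ≤ k ∧ 1 ≤ l ∧ N.HasLinearSolution F k l ∧ r = (k : ℝ≥0∞) / (l : ℝ≥0∞)}

end Network

/-- The data `(S, E*)` of an index coding network: a pair `(s, Y)` in `receivers` is a receiver that
demands the message of the source `s` and has the messages of the sources in `Y` as additional
information. Every source is demanded by some receiver. -/
structure IndexCoding where
  Source : Type
  finite_source : Finite Source
  receivers : Set (Source × Set Source)
  demanded : ∀ s : Source, ∃ Y : Set Source, (s, Y) ∈ receivers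

namespace IndexCoding

/-- The edges of the network with `m` intermediate nodes: from every source to every intermediate
node, from every intermediate node to every receiver, and from the sources in `Y` to the receiver
`(s, Y)`. -/
def blockEdge (N : IndexCoding) (m : ℕ) : N.Source ⊕ Fin m → Fin m ⊕ N.receivers → Prop
  | Sum.inl _, Sum.inl _ => True
  | Sum.inr _, Sum.inr _ => True
  | Sum.inl s, Sum.inr t => s ∈ t.1.2
  | Sum.inr _, Sum.inl _ => False

/-- The `m`-index coding network `N[m]`; the index coding network itself is the case `m = 1`. -/
def block (N : IndexCoding) (m : ℕ) : Network where
  Source := N.Source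
  Inner := Fin m
  Receiver := N.receivers
  finite_source := N.finite_source
  finite_inner := inferInstance
  finite_receiver := by
    have := N.finite_source
    infer_instance
  edge := N.blockEdge m
  acyclic := by
    intro v h
    obtain ⟨_, _, h⟩ := Relation.TransGen.tail'_iff.mp h
    exact h
  demand := fun t => t.1.1
  demand_surjective := fun s => by
    obtain ⟨Y, hY⟩ := N.demanded s
    exact ⟨⟨(s, Y), hY⟩, rfl⟩

/-- The lexicographic product of index coding networks. -/
def lex (N₁ N₂ : IndexCoding) : IndexCoding where
  Source := N₁.Source × N₂.Source
  finite_source := by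
    have := N₁.finite_source
    have := N₂.finite_source
    infer_instance
  receivers := {t | ∃ t₁ ∈ N₁.receivers, ∃ t₂ ∈ N₂.receivers,
    t = ((t₁.1, t₂.1), (t₁.2 ×ˢ Set.univ) ∪ ({t₁.1} ×ˢ t₂.2))}
  demanded := by
    rintro ⟨s₁, s₂⟩
    obtain ⟨Y₁, h₁⟩ := N₁.demanded s₁
    obtain ⟨Y₂, h₂⟩ := N₂.demanded s₂
    exact ⟨_, (s₁, Y₁), h₁, (s₂, Y₂), h₂, rfl⟩

/-- One source, and one receiver that demands it without additional information. -/
def single : IndexCoding where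
  Source := Unit
  finite_source := inferInstance
  receivers := {((), ∅)}
  demanded := fun _ => ⟨∅, rfl⟩

/-- The `k`-fold lexicographic power `N • (N • (⋯ • N))`. The value at `k = 0` is a convention. -/
def lexPow (N : IndexCoding) : ℕ → IndexCoding
  | 0 => single
  | 1 => N
  | k + 2 => N.lex (N.lexPow (k + 1))

/-- The index coding network of a family `𝒞` of subsets of a finite set that cover this set: for
each `Y ∈ 𝒞` and `s ∈ Y` there is a receiver demanding `s` that knows `Y - s`. -/
def ofFamily {S : Type} [Finite S] (𝒞 : Set (Set S)) (h : ∀ s, ∃ Y ∈ 𝒞, s ∈ Y) :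
    IndexCoding where
  Source := S
  finite_source := inferInstance
  receivers := {t | ∃ Y ∈ 𝒞, t.1 ∈ Y ∧ t.2 = Y \ {t.1}}
  demanded := fun s => by
    obtain ⟨Y, hY, hs⟩ := h s
    exact ⟨Y \ {s}, Y, hY, hs, rfl⟩

end IndexCoding

/-- The ground set `{A₁, …, Aₙ₊₁, B₁, …, Bₙ₊₁, C}`. -/
inductive Ground (n : ℕ) : Type
  | A (i : Fin (n + 1)) : Ground n
  | B (i : Fin (n + 1)) : Ground n
  | C : Ground n

namespace Ground

instance instFinite (n : ℕ) : Finite (Ground n) :=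
  Finite.of_surjective
    (fun u : Fin (n + 1) ⊕ Fin (n + 1) ⊕ Unit => match u with
      | Sum.inl i => A i
      | Sum.inr (Sum.inl i) => B i
      | Sum.inr (Sum.inr _) => (C : Ground n))
    (fun x => by
      cases x with
      | A i => exact ⟨Sum.inl i, rfl⟩
      | B i => exact ⟨Sum.inr (Sum.inl i), rfl⟩
      | C => exact ⟨Sum.inr (Sum.inr ()), rfl⟩)

/-- The sets common to both families: `A_{[n+1]} C`, `A_{[n+1]-i} B_i` and `A_i B_i C`. -/
def commonFamily (n : ℕ) : Set (Set (Ground n)) :=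
  {Y | Y = Set.range A ∪ {C} ∨ (∃ i, Y = A '' {i}ᶜ ∪ {B i}) ∨ ∃ i, Y = {A i, B i, C}}

/-- The family `𝒜ₙ`: the common sets and `B_{[n+1]}`. -/
def familyA (n : ℕ) : Set (Set (Ground n)) :=
  commonFamily n ∪ {Set.range B}

/-- The family `ℬₙ`: the common sets and `B_{[n+1]} C`. -/
def familyB (n : ℕ) : Set (Set (Ground n)) :=
  commonFamily n ∪ {Set.range B ∪ {C}}

theorem commonFamily_cover (n : ℕ) (s : Ground n) : ∃ Y ∈ commonFamily n, s ∈ Y := by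
  cases s with
  | A i => exact ⟨{A i, B i, C}, Or.inr (Or.inr ⟨i, rfl⟩), by simp⟩
  | B i => exact ⟨{A i, B i, C}, Or.inr (Or.inr ⟨i, rfl⟩), by simp⟩
  | C => exact ⟨Set.range A ∪ {C}, Or.inl rfl, by simp⟩

end Ground

/-- The index coding network `N_{𝒜ₙ}`. -/
def networkA (n : ℕ) : IndexCoding :=
  IndexCoding.ofFamily (Ground.familyA n) fun s => by
    obtain ⟨Y, hY, hs⟩ := Ground.commonFamily_cover n s
    exact ⟨Y, Or.inl hY, hs⟩

/-- The index coding network `N_{ℬₙ}`. -/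
def networkB (n : ℕ) : IndexCoding :=
  IndexCoding.ofFamily (Ground.familyB n) fun s => by
    obtain ⟨Y, hY, hs⟩ := Ground.commonFamily_cover n s
    exact ⟨Y, Or.inl hY, hs⟩

/-! ### Linear algebra -/

section LinearAlgebra

open Module

variable {F : Type*} [Field F]

/-! Solvability is a question about supports: a matrix whose row space contains, for each set of the
family, a vector with exactly that support is a scalar code. The `n + 2` rows of `parityCheck`
realise the common sets, and one further combination has support `B_{[n+1]}` if `n = 0` in `F` and
`B_{[n+1]} C` otherwise. The `n + 3` rows of `largeParityCheck` serve both families over every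
field. Kronecker products pass to powers.

For the converse, let `K` be the space of message tuples with zero broadcast and `δ = (n + 1) k -
dim K`. On `K` the common sets force `c = ∑ M i (a i) = P i (a i) + Q i (b i)` with `rank (M i - P
i) ≤ δ`, and where all `(M i - P i) (a i)` vanish, `∑ Q i (b i) = n c`. If `n ≠ 0`, the set
`B_{[n+1]}` then gives `dim K ≤ (n + 1) δ + n k`. If `n = 0`, the set `B_{[n+1]} C` and `dim ker (Q
0) ≤ δ` give `dim K ≤ (n + 2) δ + n k`. So a broadcast has dimension at least `(n + 2 + 1 / q) k`,
with `q = n + 2` or `q = n + 3`.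

`RateBound` states such a bound for subspaces relative to a base subspace, which makes it
multiplicative under `lex`. Passing from subspaces to `k` generic vectors needs an infinite field,
hence the algebraic closure. -/

theorem LinearMap.exists_factor_of_forall_eq_zero {V V₁ V₂ : Type*} [AddCommGroup V] [Module F V]
    [AddCommGroup V₁] [Module F V₁] [AddCommGroup V₂] [Module F V₂] (f : V →ₗ[F] V₁)
    (g : V →ₗ[F] V₂) (h : ∀ x, f x = 0 → g x = 0) : ∃ r : V₁ →ₗ[F] V₂, ∀ x, g x = r (f x) := by
  obtain ⟨r, hr⟩ := LinearMap.exists_extend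
    ((f.ker.liftQ g fun x hx => h x hx) ∘ₗ (f.quotKerEquivRange.symm : f.range →ₗ[F] _))
  refine ⟨r, fun x => ?_⟩
  have := LinearMap.congr_fun hr ⟨f x, x, rfl⟩
  simp only [LinearMap.coe_comp, Function.comp_apply, Submodule.coe_subtype,
    LinearEquiv.coe_coe] at this
  rw [this]
  have h2 : f.quotKerEquivRange.symm ⟨f x, x, rfl⟩ = f.ker.mkQ x := by
    rw [LinearEquiv.symm_apply_eq]
    exact Subtype.ext rfl
  rw [h2]
  exact (Submodule.liftQ_apply _ _ _).symm

/-- If `g` embeds the common kernel of the maps `f i` into `G`, then `finrank V` is at most the sum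
of the ranks of the `f i` and the dimension of `G`. -/
theorem finrank_le_sum_finrank_range_add {ι : Type*} [Fintype ι] {V V' : Type*} {V₁ : Type*}
    [AddCommGroup V] [Module F V] [FiniteDimensional F V] [AddCommGroup V'] [Module F V']
    [FiniteDimensional F V'] [AddCommGroup V₁] [Module F V₁] [FiniteDimensional F V₁]
    (f : ι → V →ₗ[F] V₁) (g : V →ₗ[F] V') (G : Submodule F V')
    (hG : ∀ x, (∀ i, f i x = 0) → g x ∈ G) (h : ∀ x, (∀ i, f i x = 0) → g x = 0 → x = 0) :
    finrank F V ≤ ∑ i, finrank F (f i).range + finrank F G := by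
  let p : V →ₗ[F] (∀ i, (f i).range) := LinearMap.pi fun i => (f i).rangeRestrict
  have hp : ∀ x, p x = 0 ↔ ∀ i, f i x = 0 := fun x => by
    simp only [p, funext_iff, LinearMap.pi_apply, Pi.zero_apply]
    exact forall_congr' fun i => Subtype.ext_iff
  rw [← p.finrank_range_add_finrank_ker]
  refine add_le_add ((Submodule.finrank_le _).trans (Module.finrank_pi_fintype F).le) ?_
  let q : p.ker →ₗ[F] G := (g ∘ₗ p.ker.subtype).codRestrict G fun x =>
    hG _ ((hp _).1 x.2)
  refine LinearMap.finrank_le_finrank_of_injective (f := q) ?_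
  rw [injective_iff_map_eq_zero]
  intro x hx
  exact Subtype.ext (h _ ((hp _).1 x.2) (congrArg Subtype.val hx))

/-- A subspace that adds at least `k` dimensions to each of finitely many subspaces contains `k`
vectors that are independent modulo each of them. -/
theorem exists_vectors_disjoint_of_finrank_add_le [Infinite F] {W : Type*} [AddCommGroup W]
    [Module F W] [FiniteDimensional F W] {ι : Type*} [Finite ι] (V : Submodule F W) (k : ℕ)
    (U : ι → Submodule F W) (h : ∀ i, finrank F (U i) + k ≤ finrank F (V ⊔ U i : Submodule F W)) :
    ∃ v : Fin k → W, (∀ j, v j ∈ V) ∧ ∀ i (x : Fin k → F), ∑ j, x j • v j ∈ U i → x = 0 := by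
  classical
  induction k generalizing U with
  | zero => exact ⟨Fin.elim0, fun j => j.elim0, fun i x _ => Subsingleton.elim _ _⟩
  | succ k ih =>
    -- Over an infinite field `V` is not a finite union of proper subspaces.
    obtain ⟨v, hv⟩ : ∃ v : V, ∀ i, (v : W) ∉ U i := by
      by_contra! hcon
      have := Fintype.ofFinite ι
      let s : Finset (Submodule F V) := Finset.univ.image fun i => (U i).comap V.subtype
      have htop : ⊤ ∈ s := by
        refine Subspace.top_mem_of_biUnion_eq_univ (k := F) (Set.eq_univ_of_forall fun v => ?_)
        obtain ⟨i, hi⟩ := hcon v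
        exact Set.mem_biUnion (Finset.mem_image_of_mem _ (Finset.mem_univ i)) hi
      obtain ⟨i, -, hi⟩ := Finset.mem_image.1 htop
      have hle : V ≤ U i := Submodule.comap_subtype_eq_top.1 hi
      have := h i
      rw [sup_eq_right.2 hle] at this
      omega
    -- Adjoining `v` raises each `U i` by at most one dimension and leaves `V ⊔ U i` unchanged.
    obtain ⟨w, hw, hw'⟩ := ih (fun i => U i ⊔ Submodule.span F {(v : W)}) fun i => by
      have h1 : V ⊔ (U i ⊔ Submodule.span F {(v : W)}) = V ⊔ U i := by
        rw [← sup_assoc, sup_eq_left]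
        exact (Submodule.span_singleton_le_iff_mem _ _).2 (Submodule.mem_sup_left v.2)
      have h2 := Submodule.finrank_add_le_finrank_add_finrank (U i) (Submodule.span F {(v : W)})
      have h3 := finrank_span_singleton (K := F) (v := (v : W)) fun h0 => hv i (h0 ▸ zero_mem _)
      have := h i
      rw [h1]
      omega
    refine ⟨Fin.cons v w, Fin.cases v.2 hw, fun i x hx => ?_⟩
    simp only [Fin.sum_univ_succ, Fin.cons_zero, Fin.cons_succ] at hx
    have htail : (fun j => x (Fin.succ j)) = 0 := hw' i _ <| by
      rw [← add_sub_cancel_left (x 0 • (v : W)) (∑ j, x (Fin.succ j) • w j), sub_eq_add_neg]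
      exact add_mem (Submodule.mem_sup_left hx) (Submodule.mem_sup_right
        (neg_mem (Submodule.smul_mem _ _ (Submodule.mem_span_singleton_self _))))
    have hzero : x 0 = 0 := by
      by_contra hne
      refine hv i ((Submodule.smul_mem_iff _ hne).1 ?_)
      simpa [fun j => congrFun htail j] using hx
    funext j
    exact Fin.cases hzero (fun j => congrFun htail j) j

end LinearAlgebra

/-! ### Rank inequalities for the two families -/

section Rank

open Module

variable {F : Type*} [Field F] {n k : ℕ} {K : Type*} [AddCommGroup K] [Module F K]

/-- Linear maps `a i`, `b i`, `c` that are jointly injective, with the dependencies that the sets in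
`Ground.commonFamily n` impose. -/
structure CommonDependencies (a b : Fin (n + 1) → K →ₗ[F] (Fin k → F))
    (c : K →ₗ[F] (Fin k → F)) : Prop where
  c_of_a : ∀ x, (∀ i, a i x = 0) → c x = 0
  a_of_ac : ∀ x i, (∀ j ≠ i, a j x = 0) → c x = 0 → a i x = 0
  b_of_a : ∀ x i, (∀ j ≠ i, a j x = 0) → b i x = 0
  c_of_ab : ∀ x i, a i x = 0 → b i x = 0 → c x = 0
  a_of_bc : ∀ x i, b i x = 0 → c x = 0 → a i x = 0
  eq_zero : ∀ x, (∀ i, a i x = 0) → (∀ i, b i x = 0) → c x = 0 → x = 0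

namespace CommonDependencies

variable {a b : Fin (n + 1) → K →ₗ[F] (Fin k → F)} {c : K →ₗ[F] (Fin k → F)}

theorem eq_zero_of_a (h : CommonDependencies a b c) {x : K} (hx : ∀ i, a i x = 0) : x = 0 :=
  h.eq_zero x hx (fun i => h.b_of_a x i fun j _ => hx j) (h.c_of_a x hx)

/-- The maps `M i`, `P i`, `Q i` that express `c` through the `a i` and through `a i`, `b i`; the
defects of `M i = P i` and of the injectivity of `Q 0` are bounded. -/
theorem exists_coefficients [FiniteDimensional F K] (h : CommonDependencies a b c) (hn : 1 ≤ n) :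
    ∃ M P Q : Fin (n + 1) → (Fin k → F) →ₗ[F] (Fin k → F),
      (∀ x, c x = ∑ i, M i (a i x)) ∧ (∀ x i, c x = P i (a i x) + Q i (b i x)) ∧
      (∀ i, finrank F (M i - P i).range + finrank F K ≤ (n + 1) * k) ∧
      finrank F (Q 0).ker + finrank F K ≤ (n + 1) * k := by
  obtain ⟨m, hm⟩ := LinearMap.exists_factor_of_forall_eq_zero (LinearMap.pi a) c fun x hx =>
    h.c_of_a x fun i => congrFun hx i
  choose r hr using fun i => LinearMap.exists_factor_of_forall_eq_zero ((a i).prod (b i)) c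
    fun x hx => h.c_of_ab x i (congrArg Prod.fst hx) (congrArg Prod.snd hx)
  have hM : ∀ x, c x = ∑ i, (m ∘ₗ LinearMap.single F _ i) (a i x) := fun x => by
    rw [hm x]
    conv_lhs => rw [← LinearMap.sum_single_apply (fun _ : Fin (n + 1) => Fin k → F)
      (LinearMap.pi a x)]
    simp [map_sum]
  have hPQ : ∀ x i, c x = (r i ∘ₗ LinearMap.inl F _ _) (a i x) +
      (r i ∘ₗ LinearMap.inr F _ _) (b i x) := fun x i => by
    rw [hr i x]
    simp [← map_add]
  refine ⟨_, _, _, hM, hPQ, fun i => ?_, ?_⟩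
  · set M := fun i => m ∘ₗ LinearMap.single F (fun _ : Fin (n + 1) => Fin k → F) i with hMdef
    set P := fun i => r i ∘ₗ LinearMap.inl F (Fin k → F) (Fin k → F) with hPdef
    -- Where all `a j` with `j ≠ i` vanish, so does `b i`. The two expressions for `c` then agree,
    -- and `a i` embeds this kernel into `ker (M i - P i)`.
    have key := finrank_le_sum_finrank_range_add (fun j : {j // j ≠ i} => a j) (a i)
      (M i - P i).ker (fun x hx => by
        have h1 := hM x
        have h2 := hPQ x i
        rw [Finset.sum_eq_single i (fun j _ hj => by rw [hx ⟨j, hj⟩, map_zero]) (by simp)] at h1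
        rw [h.b_of_a x i fun j hj => hx ⟨j, hj⟩, map_zero, add_zero] at h2
        rw [LinearMap.mem_ker, LinearMap.sub_apply, sub_eq_zero]
        exact h1.symm.trans h2)
      (fun x hx h0 => h.eq_zero_of_a fun j => by
        by_cases hj : j = i
        · rw [hj, h0]
        · exact hx ⟨j, hj⟩)
    have h3 := (M i - P i).finrank_range_add_finrank_ker
    have h4 : ∑ j : {j // j ≠ i}, finrank F (a j).range ≤ n * k := by
      refine (Finset.sum_le_card_nsmul _ _ k fun j _ =>
        (Submodule.finrank_le _).trans (by simp)).trans ?_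
      simp [Fintype.card_subtype_compl]
    simp only [finrank_fintype_fun_eq_card, Fintype.card_fin] at h3
    change finrank F (M i - P i).range + _ ≤ _
    rw [add_mul, one_mul]
    omega
  -- Omitting an index `i₁ ≠ 0` keeps `a 0` among the vanishing maps. There `c = Q 0 (b 0)`, and `c`
  -- is injective.
  · obtain ⟨i₁, hi₁⟩ : ∃ i₁ : Fin (n + 1), i₁ ≠ 0 :=
      ⟨Fin.last n, by simp [Fin.ext_iff]; omega⟩
    set Q := r 0 ∘ₗ LinearMap.inr F (Fin k → F) (Fin k → F) with hQdef
    have key := finrank_le_sum_finrank_range_add (fun j : {j // j ≠ i₁} => a j) c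
      Q.range (fun x hx => by
        have h2 := hPQ x 0
        rw [hx ⟨0, hi₁.symm⟩, map_zero, zero_add] at h2
        exact ⟨b 0 x, h2.symm⟩)
      (fun x hx h0 => h.eq_zero_of_a fun j => by
        by_cases hj : j = i₁
        · rw [hj]
          exact h.a_of_ac x i₁ (fun j hj => hx ⟨j, hj⟩) h0
        · exact hx ⟨j, hj⟩)
    have h3 := Q.finrank_range_add_finrank_ker
    have h4 : ∑ j : {j // j ≠ i₁}, finrank F (a j).range ≤ n * k := by
      refine (Finset.sum_le_card_nsmul _ _ k fun j _ =>
        (Submodule.finrank_le _).trans (by simp)).trans ?_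
      simp [Fintype.card_subtype_compl]
    simp only [finrank_fintype_fun_eq_card, Fintype.card_fin] at h3
    rw [add_mul, one_mul]
    omega

/-- Each `Q i (b i x)` equals `c x - M i (a i x)`. Summing over `n + 1` indices leaves `(n + 1) c -
c`. -/
theorem eq_sum_of_mem_ker {M P Q : Fin (n + 1) → (Fin k → F) →ₗ[F] (Fin k → F)}
    (hM : ∀ x, c x = ∑ i, M i (a i x)) (hPQ : ∀ x i, c x = P i (a i x) + Q i (b i x)) {x : K}
    (hx : ∀ i, (M i - P i) (a i x) = 0) : ∑ i, Q i (b i x) = (n : F) • c x := by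
  have h1 : ∀ i, Q i (b i x) = c x - M i (a i x) := fun i => by
    have := hx i
    rw [LinearMap.sub_apply, sub_eq_zero] at this
    rw [this, hPQ x i, add_sub_cancel_left]
  rw [Finset.sum_congr rfl fun i _ => h1 i, Finset.sum_sub_distrib, ← hM x]
  simp [add_smul, ← Nat.cast_smul_eq_nsmul F]

/-- The cost shared by both final estimates: `n + 1` conditions of rank at most the defect `δ`, and
`n` of the maps `b i` of rank at most `k`. -/
theorem sum_finrank_range_le {T : Fin (n + 1) → (Fin k → F) →ₗ[F] (Fin k → F)}
    (hT : ∀ i, finrank F (T i).range + finrank F K ≤ (n + 1) * k) :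
    (∑ i : Fin (n + 1) ⊕ Fin n,
      finrank F (Sum.elim (fun i => T i ∘ₗ a i) (fun j => b j.succ) i).range) +
      (n + 1) * finrank F K ≤ (n + 1) * ((n + 1) * k) + n * k := by
  rw [Fintype.sum_sum_type]
  change (∑ i, finrank F (T i ∘ₗ a i).range + ∑ j : Fin n, finrank F (b j.succ).range) + _ ≤ _
  have h1 : ∑ i, finrank F (T i ∘ₗ a i).range + (n + 1) * finrank F K ≤
      (n + 1) * ((n + 1) * k) := by
    calc _ = ∑ i : Fin (n + 1), (finrank F (T i ∘ₗ a i).range + finrank F K) := by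
          simp [Finset.sum_add_distrib]
      _ ≤ ∑ i : Fin (n + 1), (n + 1) * k := Finset.sum_le_sum fun i _ =>
          (Nat.add_le_add_right (Submodule.finrank_mono (LinearMap.range_comp_le_range _ _)) _).trans
            (hT i)
      _ = _ := by simp
  have h2 : ∑ j : Fin n, finrank F (b j.succ).range ≤ n * k := by
    refine (Finset.sum_le_card_nsmul _ _ k fun j _ =>
      (Submodule.finrank_le _).trans (by simp)).trans ?_
    simp
  omega

/-- If each `b i` is determined by the other ones and `n ≠ 0` in `F`. -/
theorem finrank_le_of_ne_zero [FiniteDimensional F K] (h : CommonDependencies a b c)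
    (hn : 1 ≤ n) (hF : (n : F) ≠ 0) (hb : ∀ x i, (∀ j ≠ i, b j x = 0) → b i x = 0) :
    (n + 2) * finrank F K + k ≤ (n + 2) * ((n + 1) * k) := by
  obtain ⟨M, P, Q, hM, hPQ, hT, -⟩ := h.exists_coefficients hn
  have key := finrank_le_sum_finrank_range_add
    -- `b 0` is left out because the other `b j` determine it. The common kernel is zero, hence the
    -- trivial target.
    (Sum.elim (fun i => (M i - P i) ∘ₗ a i) (fun j : Fin n => b j.succ)) (0 : K →ₗ[F] K) ⊥
    (fun x _ => by simp) (fun x hx _ => by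
      have hb0 : ∀ i, b i x = 0 := by
        have hs : ∀ j : Fin n, b j.succ x = 0 := fun j => hx (Sum.inr j)
        refine Fin.cases (hb x 0 fun j hj => ?_) hs
        obtain ⟨j, rfl⟩ := Fin.exists_succ_eq.2 hj
        exact hs j
      have hc : c x = 0 := by
        have := eq_sum_of_mem_ker hM hPQ fun i => hx (Sum.inl i)
        simp only [hb0, map_zero, Finset.sum_const_zero] at this
        exact (smul_eq_zero.1 this.symm).resolve_left hF
      exact h.eq_zero_of_a fun i => h.a_of_bc x i (hb0 i) hc)
  have h1 := sum_finrank_range_le (a := a) (b := b) hT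
  rw [finrank_bot] at key
  nlinarith

/-- If `c` is determined by the `b i` and `n = 0` in `F`. -/
theorem finrank_le_of_eq_zero [FiniteDimensional F K] (h : CommonDependencies a b c)
    (hn : 1 ≤ n) (hF : (n : F) = 0) (hb : ∀ x, (∀ i, b i x = 0) → c x = 0) :
    (n + 3) * finrank F K + k ≤ (n + 3) * ((n + 1) * k) := by
  obtain ⟨M, P, Q, hM, hPQ, hT, hQ⟩ := h.exists_coefficients hn
  have key := finrank_le_sum_finrank_range_add
    -- On the common kernel only the term `Q 0 (b 0)` of the sum is left, and it is zero. So `b 0`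
    -- costs `dim ker (Q 0) ≤ δ` instead of `k`.
    (Sum.elim (fun i => (M i - P i) ∘ₗ a i) (fun j : Fin n => b j.succ)) (b 0) (Q 0).ker
    (fun x hx => by
      have := eq_sum_of_mem_ker hM hPQ fun i => hx (Sum.inl i)
      rw [hF, zero_smul, Fin.sum_univ_succ, Finset.sum_eq_zero, add_zero] at this
      · exact this
      · intro j _
        rw [show b j.succ x = 0 from hx (Sum.inr j), map_zero])
    (fun x hx h0 => by
      have hb0 : ∀ i, b i x = 0 := Fin.cases h0 fun j => hx (Sum.inr j)
      exact h.eq_zero_of_a fun i => h.a_of_bc x i (hb0 i) (hb x hb0))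
  have h1 := sum_finrank_range_le (a := a) (b := b) hT
  nlinarith

end CommonDependencies

end Rank

/-! ### Matrix form of linear index codes -/

namespace IndexCoding

open scoped Kronecker

/-- No receiver knows the message that it demands. -/
def Irredundant (N : IndexCoding) : Prop := ∀ t ∈ N.receivers, t.1 ∉ t.2

/-- A linear index code: the messages are in `F ^ κ`, the broadcast message is
`∑ s, E s *ᵥ x s` in `F ^ ρ`, and for each receiver some matrix `D` extracts the demanded message
up to the messages that the receiver knows. -/
def HasMatrixCode (N : IndexCoding) (F : Type*) [Field F] (κ ρ : Type) [Fintype κ] [DecidableEq κ]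
    [Fintype ρ] : Prop :=
  ∃ E : N.Source → Matrix ρ κ F, ∀ t ∈ N.receivers, ∃ D : Matrix κ ρ F,
    D * E t.1 = 1 ∧ ∀ u, u ∉ t.2 → u ≠ t.1 → D * E u = 0

/-! ### Base change, parallel copies and products of codes. -/

section Codes

variable {F : Type*} [Field F] {κ κ' ρ ρ' : Type} [Fintype κ] [DecidableEq κ] [Fintype ρ]
  [Fintype κ'] [DecidableEq κ'] [Fintype ρ']

theorem HasMatrixCode.reindex {N : IndexCoding} (h : N.HasMatrixCode F κ ρ) (e : κ' ≃ κ)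
    (f : ρ' ≃ ρ) : N.HasMatrixCode F κ' ρ' := by
  obtain ⟨E, hE⟩ := h
  refine ⟨fun s => (E s).submatrix f e, fun t ht => ?_⟩
  obtain ⟨D, h1, h2⟩ := hE t ht
  refine ⟨D.submatrix e f, ?_, fun u hu hu' => ?_⟩
  · rw [Matrix.submatrix_mul_equiv, h1, Matrix.submatrix_one_equiv]
  · rw [Matrix.submatrix_mul_equiv, h2 u hu hu']
    rfl

theorem HasMatrixCode.map {N : IndexCoding} (h : N.HasMatrixCode F κ ρ) {L : Type*} [Field L]
    (φ : F →+* L) : N.HasMatrixCode L κ ρ := by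
  obtain ⟨E, hE⟩ := h
  refine ⟨fun s => (E s).map φ, fun t ht => ?_⟩
  obtain ⟨D, h1, h2⟩ := hE t ht
  refine ⟨D.map φ, ?_, fun u hu hu' => ?_⟩
  · rw [← Matrix.map_mul, h1, Matrix.map_one _ φ.map_zero φ.map_one]
  · rw [← Matrix.map_mul, h2 u hu hu', Matrix.map_zero _ φ.map_zero]

theorem HasMatrixCode.prod_one {N : IndexCoding} (h : N.HasMatrixCode F κ ρ) (ν : Type)
    [Fintype ν] [DecidableEq ν] : N.HasMatrixCode F (ν × κ) (ν × ρ) := by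
  obtain ⟨E, hE⟩ := h
  refine ⟨fun s => (1 : Matrix ν ν F) ⊗ₖ E s, fun t ht => ?_⟩
  obtain ⟨D, h1, h2⟩ := hE t ht
  refine ⟨1 ⊗ₖ D, ?_, fun u hu hu' => ?_⟩
  · rw [← Matrix.mul_kronecker_mul, h1, one_mul, Matrix.one_kronecker_one]
  · rw [← Matrix.mul_kronecker_mul, h2 u hu hu', Matrix.kronecker_zero]

/-- For an unknown source `(u, v)`, either `u` is unknown in `N₁` and the first Kronecker factor
vanishes, or `u` is the demanded source, `v` is unknown in `N₂` and the second one does. -/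
theorem HasMatrixCode.lex {N₁ N₂ : IndexCoding} (h₁ : N₁.HasMatrixCode F κ ρ)
    (h₂ : N₂.HasMatrixCode F κ' ρ') : (N₁.lex N₂).HasMatrixCode F (κ × κ') (ρ × ρ') := by
  obtain ⟨E₁, hE₁⟩ := h₁
  obtain ⟨E₂, hE₂⟩ := h₂
  refine ⟨fun s => E₁ s.1 ⊗ₖ E₂ s.2, ?_⟩
  rintro _ ⟨t₁, ht₁, t₂, ht₂, rfl⟩
  obtain ⟨D₁, h1, h1'⟩ := hE₁ t₁ ht₁
  obtain ⟨D₂, h2, h2'⟩ := hE₂ t₂ ht₂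
  refine ⟨D₁ ⊗ₖ D₂, ?_, ?_⟩
  · rw [← Matrix.mul_kronecker_mul, h1, h2, Matrix.one_kronecker_one]
  · rintro ⟨u, v⟩ hu hu'
    rw [← Matrix.mul_kronecker_mul]
    by_cases h : u = t₁.1
    · rw [h2' v (fun h' => hu (Or.inr ⟨h, h'⟩)) (fun h' => hu' (Prod.ext h h')),
        Matrix.kronecker_zero]
    · rw [h1' u (fun h' => hu (Or.inl ⟨h', trivial⟩)) h, Matrix.zero_kronecker]

theorem HasMatrixCode.lexPow {N : IndexCoding} {q r : ℕ} (h : N.HasMatrixCode F (Fin q) (Fin r))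
    (j : ℕ) : (N.lexPow (j + 1)).HasMatrixCode F (Fin (q ^ (j + 1))) (Fin (r ^ (j + 1))) := by
  induction j with
  | zero => exact h.reindex (finCongr (by simp)) (finCongr (by simp))
  | succ j ih =>
    exact HasMatrixCode.reindex (N := N.lex (N.lexPow (j + 1))) (h.lex ih)
      ((finCongr (by ring)).trans finProdFinEquiv.symm)
      ((finCongr (by ring)).trans finProdFinEquiv.symm)

end Codes

theorem Irredundant.lex {N₁ N₂ : IndexCoding} (h₁ : N₁.Irredundant) (h₂ : N₂.Irredundant) :
    (N₁.lex N₂).Irredundant := by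
  rintro _ ⟨t₁, ht₁, t₂, ht₂, rfl⟩ (⟨h, -⟩ | ⟨-, h⟩)
  exacts [h₁ t₁ ht₁ h, h₂ t₂ ht₂ h]

theorem Irredundant.lexPow {N : IndexCoding} (h : N.Irredundant) (j : ℕ) :
    (N.lexPow (j + 1)).Irredundant := by
  induction j with
  | zero => exact h
  | succ j ih => exact h.lex ih

theorem irredundant_ofFamily {S : Type} [Finite S] (𝒞 : Set (Set S))
    (h : ∀ s, ∃ Y ∈ 𝒞, s ∈ Y) : (ofFamily 𝒞 h).Irredundant := by
  rintro t ⟨Y, -, -, ht⟩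
  rw [ht]
  exact fun h => h.2 rfl

/-! ### Matrix codes versus linear network solutions. -/

section Network

variable {F : Type*} [Field F] {k l m : ℕ}

/-- A receiver subtracts the broadcast of the messages it knows and then applies `D`. By
irredundancy this leaves the demanded message intact. -/
theorem HasMatrixCode.hasLinearSolution {N : IndexCoding} (hN : N.Irredundant)
    (h : N.HasMatrixCode F (Fin k) (Fin m × Fin l)) : (N.block m).HasLinearSolution F k l := by
  classical
  have := N.finite_source
  let _ := Fintype.ofFinite N.Source
  obtain ⟨E, hE⟩ := h
  choose D hD1 hD2 using fun t : N.receivers => hE t.1 t.2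
  let g : (N.Source → Fin k → F) →ₗ[F] (Fin m × Fin l → F) :=
    ∑ s, (E s).mulVecLin ∘ₗ LinearMap.proj s
  have hg : ∀ t x, (∀ s ∈ t.1.2, x s = 0) → (D t).mulVec (g x) = x t.1.1 := by
    intro t x hx
    simp only [g, LinearMap.sum_apply, LinearMap.comp_apply, LinearMap.proj_apply,
      Matrix.mulVecLin_apply, Matrix.mulVec_sum, Matrix.mulVec_mulVec]
    rw [Finset.sum_eq_single t.1.1]
    · rw [hD1, Matrix.one_mulVec]
    · intro u _ hu
      by_cases hut : u ∈ t.1.2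
      · rw [hx u hut, Matrix.mulVec_zero]
      · rw [hD2 t u hut hu, Matrix.zero_mulVec]
    · simp
  let ext : ∀ t : N.receivers, ({s // s ∈ t.1.2} → Fin k → F) →ₗ[F] (N.Source → Fin k → F) :=
    fun t => LinearMap.pi fun s => if h : s ∈ t.1.2 then LinearMap.proj ⟨s, h⟩ else 0
  let enc : Fin m → (({_s : N.Source // True} → Fin k → F) ×
      ({_w : Fin m // False} → Fin l → F)) →ₗ[F] (Fin l → F) := fun v =>
    LinearMap.pi fun j => LinearMap.proj (v, j) ∘ₗ g ∘ₗ
      (LinearMap.pi fun s => LinearMap.proj ⟨s, trivial⟩) ∘ₗ LinearMap.fst F _ _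
  let dec : ∀ t : N.receivers, (({s // s ∈ t.1.2} → Fin k → F) ×
      ({_w : Fin m // True} → Fin l → F)) →ₗ[F] (Fin k → F) := fun t =>
    (D t).mulVecLin ∘ₗ ((LinearMap.pi fun p => LinearMap.proj p.2 ∘ₗ
      LinearMap.proj ⟨p.1, trivial⟩) ∘ₗ LinearMap.snd F _ _ - g ∘ₗ ext t ∘ₗ LinearMap.fst F _ _)
  refine ⟨⟨fun v => enc v, fun t => dec t⟩, ⟨fun v => (enc v).isLinear, fun t => (dec t).isLinear⟩,
    fun x v j => g x (v, j), fun x v => rfl, fun (x : N.Source → Fin k → F) t => ?_⟩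
  have hx : ∀ s ∈ t.1.2, (x - ext t fun s => x s.1) s = 0 := fun s hs => by
    simp [ext, hs]
  have ht : ext t (fun s => x s.1) t.1.1 = 0 := by
    simp [ext, hN t.1 t.2]
  have := hg t _ hx
  rw [map_sub, Pi.sub_apply, ht, sub_zero] at this
  exact this

/-- The matrices are read off from tuples with one nonzero message. When its source is unknown to a
receiver, the side information there is zero. -/
theorem hasMatrixCode_of_hasLinearSolution {N : IndexCoding} (hN : N.Irredundant)
    (h : (N.block m).HasLinearSolution F k l) : N.HasMatrixCode F (Fin k) (Fin m × Fin l) := by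
  classical
  obtain ⟨c, ⟨hc1, hc2⟩, y, hy1, hy2⟩ := h
  let enc : Fin m → (({_s : N.Source // True} → Fin k → F) ×
      ({_w : Fin m // False} → Fin l → F)) →ₗ[F] (Fin l → F) := fun v => (hc1 v).mk' _
  let E : N.Source → (Fin k → F) →ₗ[F] (Fin m × Fin l → F) := fun s => LinearMap.pi fun p =>
    LinearMap.proj p.2 ∘ₗ enc p.1 ∘ₗ LinearMap.inl F _ _ ∘ₗ
      (LinearMap.pi fun w => LinearMap.proj w.1) ∘ₗ LinearMap.single F (fun _ => Fin k → F) s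
  have hE : ∀ s u p, E s u p = y (Pi.single s u) p.1 p.2 := fun s u p => by
    refine Eq.trans ?_ (congrFun (hy1 _ _) p.2).symm
    have h0 : ((fun w => (Pi.single s u : N.Source → Fin k → F) w.1, 0) :
        (N.block m).Inputs F k l (Sum.inl p.1)) =
        (N.block m).inputs (Sum.inl p.1) (Pi.single s u) (y (Pi.single s u)) :=
      Prod.ext rfl (funext fun w => False.elim w.2)
    exact congrFun (congrArg (c.enc p.1) h0) p.2
  refine ⟨fun s => LinearMap.toMatrix' (E s), fun t ht => ?_⟩
  let T : (N.block m).Receiver := ⟨t, ht⟩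
  let dec : (({s // s ∈ t.2} → Fin k → F) × ({_w : Fin m // True} → Fin l → F)) →ₗ[F]
      (Fin k → F) := (hc2 T).mk' _
  let D : (Fin m × Fin l → F) →ₗ[F] (Fin k → F) := dec ∘ₗ LinearMap.inr F _ _ ∘ₗ
    LinearMap.pi fun w => LinearMap.pi fun j => LinearMap.proj (w.1, j)
  have hD : ∀ s ∉ t.2, ∀ u, D (E s u) = (Pi.single s u : N.Source → Fin k → F) t.1 := by
    intro s hs u
    refine Eq.trans ?_ (hy2 (Pi.single s u) T)
    refine congrArg (c.dec T) (Prod.ext (funext fun w => ?_) (funext fun w => funext fun j =>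
      hE s u (w.1, j)))
    have : w.1 ≠ s := fun h => hs (h ▸ w.2)
    exact (Pi.single_eq_of_ne (M := fun _ => Fin k → F) this u).symm
  refine ⟨LinearMap.toMatrix' D, ?_, fun u hu hu' => ?_⟩
  · rw [← LinearMap.toMatrix'_comp, ← LinearMap.toMatrix'_id]
    congr 1
    exact LinearMap.ext fun x => by simp [hD t.1 (hN t ht)]
  · rw [← LinearMap.toMatrix'_comp, ← map_zero LinearMap.toMatrix']
    congr 1
    exact LinearMap.ext fun x => by
      rw [LinearMap.comp_apply, hD u hu, Pi.single_eq_of_ne hu'.symm, LinearMap.zero_apply]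

end Network

end IndexCoding

/-! ### Lower bounds on the broadcast dimension -/

namespace IndexCoding

open Module

universe u

/-- The span of the messages that the receiver `t` neither demands nor knows. -/
def unknownSpan (N : IndexCoding) {F : Type*} [Field F] {W : Type*} [AddCommGroup W] [Module F W]
    (V : N.Source → Submodule F W) (t : N.Source × Set N.Source) : Submodule F W :=
  ⨆ u, ⨆ (_ : u ∉ t.2 ∧ u ≠ t.1), V u

/-- Every linear index code of `N` over `F` has broadcast rate at least `β`, where the code is given
by subspaces and may be relative to a subspace `U`: if for each receiver the demanded message adds
at least `k` dimensions to the span of `U` and of the unknown messages, then all messages add at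
least `β * k` dimensions to `U`. -/
def RateBound (N : IndexCoding) (F : Type u) [Field F] (β : ℝ) : Prop :=
  ∀ (W : Type u) [AddCommGroup W] [Module F W] [FiniteDimensional F W] (k : ℕ)
    (V : N.Source → Submodule F W) (U : Submodule F W),
    (∀ t ∈ N.receivers, finrank F (U ⊔ N.unknownSpan V t : Submodule F W) + k ≤
      finrank F (V t.1 ⊔ (U ⊔ N.unknownSpan V t) : Submodule F W)) →
    (finrank F U : ℝ) + β * k ≤ finrank F (U ⊔ ⨆ s, V s : Submodule F W)

variable {F : Type u} [Field F]

/-- The bound for `N₂`, taken relative to `U` and the messages unknown in `N₁`, shows that the block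
of a source of `N₁` adds at least `β₂ * k` dimensions. These blocks then form a code of `N₁`. This
is why the base subspace is part of `RateBound`. -/
theorem RateBound.lex {N₁ N₂ : IndexCoding} (hN₁ : N₁.Irredundant) {β₁ β₂ : ℝ} (hβ₁ : 0 ≤ β₁)
    (h₁ : N₁.RateBound F β₁) (h₂ : N₂.RateBound F β₂) : (N₁.lex N₂).RateBound F (β₁ * β₂) := by
  intro W _ _ _ k V U h
  let V₁ : N₁.Source → Submodule F W := fun s => ⨆ t : N₂.Source, V (s, t)
  have hV : ⨆ s, V s = ⨆ s, V₁ s := iSup_prod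
  -- Dimensions are integers, so the gain may be rounded up and used as the message length for `N₁`.
  have hk : ∀ t₁ ∈ N₁.receivers, finrank F (U ⊔ N₁.unknownSpan V₁ t₁ : Submodule F W) + ⌈β₂ * k⌉₊ ≤
      finrank F (V₁ t₁.1 ⊔ (U ⊔ N₁.unknownSpan V₁ t₁) : Submodule F W) := by
    intro t₁ ht₁
    have := h₂ W k (fun t => V (t₁.1, t)) (U ⊔ N₁.unknownSpan V₁ t₁) fun t₂ ht₂ => by
      have key : U ⊔ N₁.unknownSpan V₁ t₁ ⊔ N₂.unknownSpan (fun t => V (t₁.1, t)) t₂ =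
          U ⊔ (N₁.lex N₂).unknownSpan V
            ((t₁.1, t₂.1), (t₁.2 ×ˢ Set.univ) ∪ ({t₁.1} ×ˢ t₂.2)) := by
        rw [sup_assoc]
        congr 1
        refine le_antisymm (sup_le ?_ ?_) ?_
        · refine iSup₂_le fun u hu => iSup_le fun v => ?_
          exact le_iSup₂_of_le (f := fun (w : N₁.Source × N₂.Source) _ => V w) (u, v)
            ⟨fun h => h.elim (fun h => hu.1 h.1) (fun h => hu.2 h.1),
              fun h => hu.2 (congrArg Prod.fst h)⟩ le_rfl
        · refine iSup₂_le fun v hv => ?_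
          exact le_iSup₂_of_le (f := fun (w : N₁.Source × N₂.Source) _ => V w) (t₁.1, v)
            ⟨fun h => h.elim (fun h => hN₁ t₁ ht₁ h.1) (fun h => hv.1 h.2),
              fun h => hv.2 (congrArg Prod.snd h)⟩ le_rfl
        · refine iSup₂_le ?_
          rintro ⟨u, v⟩ huv
          by_cases hu : u = t₁.1
          · subst hu
            refine le_sup_of_le_right (le_iSup₂_of_le (f := fun w _ => V (t₁.1, w)) v
              ⟨fun h => huv.1 (Or.inr ⟨rfl, h⟩), fun h => huv.2 (Prod.ext rfl h)⟩ le_rfl)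
          · refine le_sup_of_le_left (le_iSup₂_of_le (f := fun w _ => V₁ w) u
              ⟨fun h => huv.1 (Or.inl ⟨h, trivial⟩), hu⟩ (le_iSup (fun v => V (u, v)) v))
      rw [key]
      exact h _ ⟨t₁, ht₁, t₂, ht₂, rfl⟩
    have h3 : ⌈β₂ * k⌉₊ ≤ finrank F (V₁ t₁.1 ⊔ (U ⊔ N₁.unknownSpan V₁ t₁) : Submodule F W) -
        finrank F (U ⊔ N₁.unknownSpan V₁ t₁ : Submodule F W) := by
      rw [Nat.ceil_le, Nat.cast_sub (Submodule.finrank_mono le_sup_right), sup_comm]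
      linarith
    have h4 := Submodule.finrank_mono (R := F)
      (le_sup_right : U ⊔ N₁.unknownSpan V₁ t₁ ≤ V₁ t₁.1 ⊔ (U ⊔ N₁.unknownSpan V₁ t₁))
    omega
  have := h₁ W ⌈β₂ * k⌉₊ V₁ U hk
  rw [hV]
  have h5 : β₁ * (β₂ * k) ≤ β₁ * ⌈β₂ * k⌉₊ := mul_le_mul_of_nonneg_left (Nat.le_ceil _) hβ₁
  linarith [mul_assoc β₁ β₂ k]

theorem RateBound.lexPow {N : IndexCoding} (hN : N.Irredundant) {β : ℝ} (hβ : 0 ≤ β)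
    (h : N.RateBound F β) (j : ℕ) : (N.lexPow (j + 1)).RateBound F (β ^ (j + 1)) := by
  induction j with
  | zero =>
    rw [zero_add, pow_one]
    exact h
  | succ j ih =>
    rw [pow_succ']
    exact RateBound.lex hN hβ h ih

theorem RateBound.le_card {N : IndexCoding} {β : ℝ} (h : N.RateBound F β) {k : ℕ} {ρ : Type}
    [Fintype ρ] (hc : N.HasMatrixCode F (Fin k) ρ) : β * k ≤ Fintype.card ρ := by
  obtain ⟨E, hE⟩ := hc
  have := h (ρ → F) k (fun s => (E s).mulVecLin.range) ⊥ fun t ht => by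
    obtain ⟨D, h1, h2⟩ := hE t ht
    rw [bot_sup_eq]
    have hle : N.unknownSpan (fun s => (E s).mulVecLin.range) t ≤ D.mulVecLin.ker := by
      refine iSup₂_le fun u hu => ?_
      rintro _ ⟨x, rfl⟩
      simp [Matrix.mulVec_mulVec, h2 u hu.1 hu.2]
    -- `D` kills the unknown span and is a left inverse of `E t.1`, so the demanded message adds its
    -- full dimension.
    have hdisj : (E t.1).mulVecLin.range ⊓ N.unknownSpan (fun s => (E s).mulVecLin.range) t = ⊥ := by
      rw [eq_bot_iff]
      rintro _ ⟨⟨x, rfl⟩, hx⟩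
      have := hle hx
      simp only [LinearMap.mem_ker, Matrix.mulVecLin_apply, Matrix.mulVec_mulVec, h1,
        Matrix.one_mulVec] at this
      simp [this]
    have hinj : Function.Injective (E t.1).mulVecLin := by
      refine Function.LeftInverse.injective (g := D.mulVec) fun x => ?_
      simp [Matrix.mulVec_mulVec, h1]
    have h3 := Submodule.finrank_sup_add_finrank_inf_eq (E t.1).mulVecLin.range
      (N.unknownSpan (fun s => (E s).mulVecLin.range) t)
    rw [hdisj, finrank_bot, LinearMap.finrank_range_of_inj hinj] at h3
    simp only [finrank_fintype_fun_eq_card, Fintype.card_fin] at h3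
    omega
  have h2 : (finrank F (⊥ ⊔ ⨆ s, (E s).mulVecLin.range : Submodule F (ρ → F)) : ℝ) ≤
      Fintype.card ρ := by
    exact_mod_cast (Submodule.finrank_le _).trans (by simp)
  rw [finrank_bot] at this
  linarith [(Nat.cast_zero : ((0 : ℕ) : ℝ) = 0)]

/-- Over an infinite field it suffices to bound the dimension of the space `K` of all tuples of
messages with broadcast message zero, for codes with messages in `F ^ k`. -/
theorem rateBound_of_forall_finrank_le [Infinite F] (N : IndexCoding) [Fintype N.Source] (β : ℝ)
    (h : ∀ (k : ℕ) (K : Submodule F (N.Source → Fin k → F)),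
      (∀ x ∈ K, ∀ t ∈ N.receivers, (∀ s ∈ t.2, x s = 0) → x t.1 = 0) →
      finrank F K + β * k ≤ Fintype.card N.Source * k) : N.RateBound F β := by
  classical
  intro W _ _ _ k V U hV
  -- The `V s` may have different dimensions. Picking `k` vectors in each, independent modulo all
  -- relevant subspaces at once, gives a code with messages in `F ^ k`.
  choose v hvV hv using fun s => exists_vectors_disjoint_of_finrank_add_le (V s) k
    (fun t : {t : N.receivers // t.1.1 = s} => U ⊔ N.unknownSpan V t.1.1)
    (by rintro ⟨t, rfl⟩; exact hV t.1 t.2)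
  let e : ∀ s, (Fin k → F) →ₗ[F] W := fun s => Fintype.linearCombination F (v s)
  have he : ∀ s x, e s x ∈ V s := fun s x => by
    rw [Fintype.linearCombination_apply]
    exact Submodule.sum_mem _ fun j _ => Submodule.smul_mem _ _ (hvV s j)
  let φ : (N.Source → Fin k → F) →ₗ[F] W := ∑ s, e s ∘ₗ LinearMap.proj s
  have hφ : ∀ x, φ x = ∑ s, e s (x s) := fun x => by simp [φ]
  let ψ : (N.Source → Fin k → F) →ₗ[F] (W ⧸ U) := U.mkQ ∘ₗ φ
  have hK := h k ψ.ker fun x hx t ht hxt => by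
    rw [LinearMap.mem_ker, LinearMap.comp_apply, Submodule.mkQ_apply,
      Submodule.Quotient.mk_eq_zero, hφ, ← Finset.add_sum_erase _ _ (Finset.mem_univ t.1)] at hx
    refine hv t.1 ⟨⟨t, ht⟩, rfl⟩ _ ?_
    rw [← Fintype.linearCombination_apply F (v t.1) (x t.1)]
    change e t.1 (x t.1) ∈ _
    rw [← add_sub_cancel_right (e t.1 (x t.1)) (∑ s ∈ Finset.univ.erase t.1, e s (x s))]
    refine sub_mem (Submodule.mem_sup_left hx) (Submodule.mem_sup_right ?_)
    refine Submodule.sum_mem _ fun s hs => ?_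
    by_cases hst : s ∈ t.2
    · rw [hxt s hst, map_zero]
      exact zero_mem _
    · exact le_iSup₂_of_le (f := fun u _ => V u) s ⟨hst, Finset.ne_of_mem_erase hs⟩ le_rfl (he _ _)
  have h1 := ψ.finrank_range_add_finrank_ker
  have h2 : finrank F ψ.range + finrank F U ≤ finrank F (U ⊔ ⨆ s, V s : Submodule F W) := by
    have hle : ψ.range ≤ (U.mkQ ∘ₗ (U ⊔ ⨆ s, V s : Submodule F W).subtype).range := by
      rintro _ ⟨x, rfl⟩
      refine ⟨⟨φ x, ?_⟩, rfl⟩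
      rw [hφ]
      exact Submodule.mem_sup_right (Submodule.sum_mem _ fun s _ =>
        le_iSup V s (he s _))
    have h3 := (U.mkQ ∘ₗ (U ⊔ ⨆ s, V s : Submodule F W).subtype).finrank_range_add_finrank_ker
    have h4 : finrank F U ≤ finrank F (U.mkQ ∘ₗ (U ⊔ ⨆ s, V s : Submodule F W).subtype).ker := by
      rw [LinearMap.ker_comp, Submodule.ker_mkQ]
      exact (Submodule.comapSubtypeEquivOfLe (le_sup_left : U ≤ U ⊔ ⨆ s, V s)).finrank_eq.ge
    have := Submodule.finrank_mono hle
    omega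
  have h3 : finrank F (N.Source → Fin k → F) = Fintype.card N.Source * k := by
    simp [finrank_pi_fintype]
  rw [h3] at h1
  have h1' : (finrank F ψ.range : ℝ) + finrank F ψ.ker = Fintype.card N.Source * k := by
    exact_mod_cast h1
  have h2' : (finrank F ψ.range : ℝ) + finrank F U ≤
      finrank F (U ⊔ ⨆ s, V s : Submodule F W) := by exact_mod_cast h2
  linarith

end IndexCoding

/-! ### Codes and capacities of lexicographic powers -/

theorem ENNReal.natCast_div_le_div_pow {a b k l j : ℕ} (hb : 0 < b) (hl : 0 < l)
    (h : k * b ^ j ≤ l * a ^ j) : (k : ℝ≥0∞) / l ≤ ((a : ℝ≥0∞) / b) ^ j := by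
  have h' : (k : NNReal) / l ≤ ((a : NNReal) / b) ^ j := by
    rw [div_pow, div_le_div_iff₀ (by positivity) (by positivity), mul_comm ((a : NNReal) ^ j)]
    exact_mod_cast h
  have := ENNReal.coe_le_coe.2 h'
  rw [ENNReal.coe_pow, ENNReal.coe_div (by positivity), ENNReal.coe_div (by positivity)] at this
  exact_mod_cast this

namespace IndexCoding

universe u

section Power

variable {F : Type u} [Field F] {N : IndexCoding}

theorem HasMatrixCode.linearlySolvable_lexPow (hN : N.Irredundant) {m : ℕ}
    (h : N.HasMatrixCode F (Fin 1) (Fin m)) (j : ℕ) :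
    ((N.lexPow (j + 1)).block (m ^ (j + 1))).LinearlySolvable F :=
  ⟨1, le_rfl, ((h.lexPow j).reindex (finCongr (one_pow _).symm)
    (Equiv.prodUnique _ _)).hasLinearSolution (hN.lexPow j)⟩

/-- `m ^ (j + 1)` parallel copies of the scalar code of the power, one copy per intermediate node,
which carries its `r ^ (j + 1)` symbols. -/
theorem HasMatrixCode.le_linearCapacity_lexPow (hN : N.Irredundant) {m r : ℕ} (hm : 0 < m)
    (hr : 0 < r) (h : N.HasMatrixCode F (Fin 1) (Fin r)) (j : ℕ) :
    ((m : ℝ≥0∞) / r) ^ (j + 1) ≤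
      ((N.lexPow (j + 1)).block (m ^ (j + 1))).linearCapacity F := by
  have hc : (N.lexPow (j + 1)).HasMatrixCode F (Fin (m ^ (j + 1)))
      (Fin (m ^ (j + 1)) × Fin (r ^ (j + 1))) :=
    (((h.lexPow j).reindex (finCongr (one_pow _).symm) (Equiv.refl _)).prod_one
      (Fin (m ^ (j + 1)))).reindex (Equiv.prodUnique _ _).symm (Equiv.refl _)
  refine le_sSup ⟨m ^ (j + 1), r ^ (j + 1), Nat.one_le_pow _ _ hm, Nat.one_le_pow _ _ hr,
    hc.hasLinearSolution (hN.lexPow j), ?_⟩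
  rw [Nat.cast_pow, Nat.cast_pow, ENNReal.div_eq_inv_mul, ENNReal.div_eq_inv_mul, mul_pow,
    ENNReal.inv_pow]

/-- The rate is at most `(m / (m + 1 / q)) ^ (j + 1)`, and `m / (m + 1 / q) = m q / (m q + 1)`. This
grows with `m q`, so any `P ≥ m q` will do. -/
theorem RateBound.linearCapacity_lexPow_le {L : Type u} [Field L] (φ : F →+* L)
    (hN : N.Irredundant) {m q P : ℕ} (hm : 0 < m) (hq : 0 < q) (hP : m * q ≤ P)
    (h : N.RateBound L (m + 1 / q)) (j : ℕ) :
    ((N.lexPow (j + 1)).block (m ^ (j + 1))).linearCapacity F ≤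
      ((P : ℝ≥0∞) / (P + 1 : ℕ)) ^ (j + 1) := by
  refine sSup_le ?_
  rintro _ ⟨k, l, -, hl, hs, rfl⟩
  refine ENNReal.natCast_div_le_div_pow P.succ_pos hl ?_
  have h1 := (h.lexPow hN (by positivity) j).le_card
    ((hasMatrixCode_of_hasLinearSolution (hN.lexPow j) hs).map φ)
  simp only [Fintype.card_prod, Fintype.card_fin, Nat.cast_mul, Nat.cast_pow] at h1
  have hq' : (0 : ℝ) < q := by exact_mod_cast hq
  have hm' : (0 : ℝ) < m := by exact_mod_cast hm
  have hP' : (m : ℝ) * q ≤ P := by exact_mod_cast hP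
  have h2 : (m : ℝ) * (P + 1) ≤ (m + 1 / q) * P := by
    have : (m : ℝ) ≤ 1 / q * P := by
      rw [one_div, inv_mul_eq_div, le_div_iff₀ hq']
      exact hP'
    linarith
  have h3 : (m : ℝ) ^ (j + 1) * (k * (P + 1) ^ (j + 1)) ≤ m ^ (j + 1) * (l * P ^ (j + 1)) := by
    calc (m : ℝ) ^ (j + 1) * (k * (P + 1) ^ (j + 1)) = (m * (P + 1)) ^ (j + 1) * k := by
          rw [mul_pow]; ring
      _ ≤ ((m + 1 / q) * P) ^ (j + 1) * k := by gcongr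
      _ = (m + 1 / q) ^ (j + 1) * k * P ^ (j + 1) := by rw [mul_pow]; ring
      _ ≤ m ^ (j + 1) * l * P ^ (j + 1) := by gcongr
      _ = _ := by ring
  exact_mod_cast le_of_mul_le_mul_left h3 (by positivity)

theorem RateBound.not_linearlySolvable_lexPow {L : Type u} [Field L] (φ : F →+* L)
    (hN : N.Irredundant) {m q : ℕ} (hm : 0 < m) (hq : 0 < q)
    (h : N.RateBound L (m + 1 / q)) (j : ℕ) :
    ¬ ((N.lexPow (j + 1)).block (m ^ (j + 1))).LinearlySolvable F := by
  rintro ⟨k, hk, hs⟩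
  have h1 : (1 : ℝ≥0∞) ≤ ((N.lexPow (j + 1)).block (m ^ (j + 1))).linearCapacity F := by
    refine le_sSup ⟨k, k, hk, hk, hs, ?_⟩
    rw [ENNReal.div_self (by exact_mod_cast (Nat.pos_iff_ne_zero.1 hk)) (ENNReal.natCast_ne_top k)]
  have h2 := h1.trans (h.linearCapacity_lexPow_le φ hN hm hq le_rfl j)
  refine absurd h2 (not_le.2 (pow_lt_one₀ zero_le ?_ j.succ_ne_zero))
  refine ENNReal.div_lt_of_lt_mul ?_
  rw [one_mul]
  exact_mod_cast Nat.lt_succ_self _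

end Power

/-! ### Index coding networks of families of sets -/

section Family

variable {S : Type} [Finite S] {𝒞 : Set (Set S)} {h𝒞 : ∀ s, ∃ Y ∈ 𝒞, s ∈ Y}

open scoped Matrix in
/-- A matrix such that each member of the family is the support of a combination of the rows
is a scalar linear index code. -/
theorem hasMatrixCode_ofFamily {F : Type*} [Field F] {ρ : Type} [Fintype ρ] (H : Matrix ρ S F)
    (h : ∀ Y ∈ 𝒞, ∃ d : ρ → F, ∀ s, (d ᵥ* H) s ≠ 0 ↔ s ∈ Y) :
    (ofFamily 𝒞 h𝒞).HasMatrixCode F (Fin 1) ρ := by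
  refine ⟨fun s => Matrix.of fun r _ => H r s, ?_⟩
  rintro ⟨s, Z⟩ ⟨Y, hY, hs, hZ⟩
  obtain ⟨d, hd⟩ := h Y hY
  have hmul : ∀ u i j, ((Matrix.of fun (_ : Fin 1) r => ((d ᵥ* H) s)⁻¹ * d r) *
      (Matrix.of fun r (_ : Fin 1) => H r u)) i j = ((d ᵥ* H) s)⁻¹ * (d ᵥ* H) u := fun u i j => by
    simp [Matrix.mul_apply, Matrix.vecMul, dotProduct, Finset.mul_sum, mul_assoc]
  refine ⟨Matrix.of fun _ r => ((d ᵥ* H) s)⁻¹ * d r, ?_, fun u hu hus => ?_⟩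
  · ext i j
    refine (hmul s i j).trans ?_
    rw [inv_mul_cancel₀ ((hd s).2 hs), Subsingleton.elim i j, Matrix.one_apply_eq]
  · have hu' : (d ᵥ* H) u = 0 := by
      by_contra hne
      refine hu ?_
      change u ∈ Z
      rw [show Z = Y \ {s} from hZ]
      exact ⟨(hd u).1 hne, hus⟩
    ext i j
    refine (hmul u i j).trans ?_
    rw [hu', mul_zero, Matrix.zero_apply]

theorem rateBound_ofFamily {F : Type u} [Field F] [Infinite F] (β : ℝ)
    (h : ∀ (k : ℕ) (K : Submodule F (S → Fin k → F)),
      (∀ x ∈ K, ∀ Y ∈ 𝒞, ∀ s ∈ Y, (∀ u ∈ Y, u ≠ s → x u = 0) → x s = 0) →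
      Module.finrank F K + β * k ≤ Nat.card S * k) : (ofFamily 𝒞 h𝒞).RateBound F β := by
  let _ : Fintype (ofFamily 𝒞 h𝒞).Source := Fintype.ofFinite S
  refine rateBound_of_forall_finrank_le _ β fun k K hK => ?_
  rw [← Nat.card_eq_fintype_card]
  exact h k K fun x hx Y hY s hs hxY =>
    hK x hx (s, Y \ {s}) ⟨Y, hY, hs, rfl⟩ fun u hu => hxY u hu.1 hu.2

end Family

end IndexCoding

/-! ### The two networks -/

namespace Ground

open Module

theorem card_eq (n : ℕ) : Nat.card (Ground n) = 2 * n + 3 := by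
  let e : Fin (n + 1) ⊕ Fin (n + 1) ⊕ Unit ≃ Ground n :=
    { toFun := Sum.elim A (Sum.elim B fun _ => C)
      invFun := fun s => match s with
        | A i => Sum.inl i
        | B i => Sum.inr (Sum.inl i)
        | C => Sum.inr (Sum.inr ())
      left_inv := by rintro (i | i | i) <;> rfl
      right_inv := by rintro (i | i | _) <;> rfl }
  rw [← Nat.card_congr e]
  simp
  ring

section RateBounds

variable {n k : ℕ} {F : Type*} [Field F]

theorem commonDependencies (K : Submodule F (Ground n → Fin k → F))
    (hK : ∀ x ∈ K, ∀ Y ∈ commonFamily n, ∀ s ∈ Y, (∀ u ∈ Y, u ≠ s → x u = 0) → x s = 0) :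
    CommonDependencies (fun i => LinearMap.proj (A i) ∘ₗ K.subtype)
      (fun i => LinearMap.proj (B i) ∘ₗ K.subtype) (LinearMap.proj C ∘ₗ K.subtype) where
  c_of_a x hx := hK x x.2 _ (Or.inl rfl) C (by simp) <| by
    rintro _ (⟨j, rfl⟩ | rfl) hu
    exacts [hx j, absurd rfl hu]
  a_of_ac x i hx hc := hK x x.2 _ (Or.inl rfl) (A i) (by simp) <| by
    rintro _ (⟨j, rfl⟩ | rfl) hu
    exacts [hx j fun h => hu (h ▸ rfl), hc]
  b_of_a x i hx := hK x x.2 _ (Or.inr (Or.inl ⟨i, rfl⟩)) (B i) (by simp) <| by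
    rintro _ (⟨j, hj, rfl⟩ | rfl) hu
    exacts [hx j hj, absurd rfl hu]
  c_of_ab x i ha hb := hK x x.2 _ (Or.inr (Or.inr ⟨i, rfl⟩)) C (by simp) <| by
    rintro _ (rfl | rfl | rfl) hu
    exacts [ha, hb, absurd rfl hu]
  a_of_bc x i hb hc := hK x x.2 _ (Or.inr (Or.inr ⟨i, rfl⟩)) (A i) (by simp) <| by
    rintro _ (rfl | rfl | rfl) hu
    exacts [absurd rfl hu, hb, hc]
  eq_zero x ha hb hc := by
    ext s : 2
    cases s with
    | A i => exact ha i
    | B i => exact hb i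
    | C => exact hc

end RateBounds

/-! ### Explicit scalar codes. -/

section Codes

open scoped Matrix

variable {n : ℕ} {F : Type*} [Field F]

/-- Parity checks `bᵢ - ∑_{j ≠ i} aⱼ` and `c - ∑ aⱼ`. -/
def parityCheck (n : ℕ) (F : Type*) [Field F] : Matrix (Fin (n + 1) ⊕ Unit) (Ground n) F
  | Sum.inl i, A j => (if j = i then 1 else 0) - 1
  | Sum.inl i, B j => if j = i then 1 else 0
  | Sum.inl _, C => 0
  | Sum.inr _, A _ => -1
  | Sum.inr _, B _ => 0
  | Sum.inr _, C => 1

/-- Parity checks `aᵢ + bᵢ`, `∑ aⱼ` and `c`. -/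
def largeParityCheck (n : ℕ) (F : Type*) [Field F] :
    Matrix (Fin (n + 1) ⊕ Unit ⊕ Unit) (Ground n) F
  | Sum.inl i, A j => if j = i then 1 else 0
  | Sum.inl i, B j => if j = i then 1 else 0
  | Sum.inl _, C => 0
  | Sum.inr (Sum.inl _), A _ => 1
  | Sum.inr (Sum.inl _), B _ => 0
  | Sum.inr (Sum.inl _), C => 0
  | Sum.inr (Sum.inr _), A _ => 0
  | Sum.inr (Sum.inr _), B _ => 0
  | Sum.inr (Sum.inr _), C => 1

theorem vecMul_parityCheck (d : Fin (n + 1) → F) (e : F) :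
    Sum.elim d (fun _ => e) ᵥ* parityCheck n F = fun s => match s with
      | A j => d j - ∑ i, d i - e
      | B j => d j
      | C => e := by
  funext s
  cases s <;>
    simp [Matrix.vecMul, dotProduct, parityCheck, mul_add, Finset.sum_add_distrib, sub_eq_add_neg]

theorem vecMul_largeParityCheck (d : Fin (n + 1) → F) (e f : F) :
    Sum.elim d (Sum.elim (fun _ => e) fun _ => f) ᵥ* largeParityCheck n F = fun s => match s with
      | A j => d j + e
      | B j => d j
      | C => f := by
  funext s
  cases s <;> simp [Matrix.vecMul, dotProduct, largeParityCheck]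

theorem exists_vecMul_parityCheck (Y : Set (Ground n)) (hY : Y ∈ commonFamily n) :
    ∃ d, ∀ s, (d ᵥ* parityCheck n F) s ≠ 0 ↔ s ∈ Y := by
  rcases hY with rfl | ⟨i, rfl⟩ | ⟨i, rfl⟩
  · refine ⟨Sum.elim 0 fun _ => 1, fun s => ?_⟩
    rw [vecMul_parityCheck]
    cases s <;> simp
  · refine ⟨Sum.elim (Pi.single i 1) fun _ => 0, fun s => ?_⟩
    rw [vecMul_parityCheck]
    cases s <;> simp [Pi.single_apply, sub_eq_zero]
  · refine ⟨Sum.elim (Pi.single i 1) fun _ => -1, fun s => ?_⟩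
    rw [vecMul_parityCheck]
    cases s <;> simp [Pi.single_apply]

/-- Here the characteristic enters: the coefficient at each `A j` is `1 - (n + 1) + n = 0`, while
`C` is in the support exactly when `n ≠ 0` in `F`. -/
theorem vecMul_parityCheck_one_neg : Sum.elim 1 (fun _ => -(n : F)) ᵥ* parityCheck n F =
    fun s => match s with
      | A _ => 0
      | B _ => 1
      | C => -(n : F) := by
  rw [vecMul_parityCheck]
  funext s
  cases s <;> simp

theorem exists_vecMul_largeParityCheck (Y : Set (Ground n)) (hY : Y ∈ familyA n ∪ familyB n) :
    ∃ d, ∀ s, (d ᵥ* largeParityCheck n F) s ≠ 0 ↔ s ∈ Y := by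
  have hY' : Y ∈ commonFamily n ∨ Y = Set.range B ∨ Y = Set.range B ∪ {C} := by
    rcases hY with (h | h) | (h | h)
    exacts [Or.inl h, Or.inr (Or.inl h), Or.inl h, Or.inr (Or.inr h)]
  rcases hY' with (rfl | ⟨i, rfl⟩ | ⟨i, rfl⟩) | rfl | rfl
  · refine ⟨Sum.elim 0 (Sum.elim (fun _ => 1) fun _ => 1), fun s => ?_⟩
    rw [vecMul_largeParityCheck]
    cases s <;> simp
  · refine ⟨Sum.elim (Pi.single i (-1)) (Sum.elim (fun _ => 1) fun _ => 0), fun s => ?_⟩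
    rw [vecMul_largeParityCheck]
    cases s <;> simp [Pi.single_apply]
    split_ifs <;> simp [*]
  · refine ⟨Sum.elim (Pi.single i 1) (Sum.elim (fun _ => 0) fun _ => 1), fun s => ?_⟩
    rw [vecMul_largeParityCheck]
    cases s <;> simp [Pi.single_apply]
  · refine ⟨Sum.elim 1 (Sum.elim (fun _ => -1) fun _ => 0), fun s => ?_⟩
    rw [vecMul_largeParityCheck]
    cases s <;> simp
  · refine ⟨Sum.elim 1 (Sum.elim (fun _ => -1) fun _ => 1), fun s => ?_⟩
    rw [vecMul_largeParityCheck]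
    cases s <;> simp

end Codes

end Ground

/-! ### Rate bounds and codes for the two networks. -/

section Networks

open IndexCoding Ground Module

universe u

variable {n : ℕ} {F : Type u} [Field F]

theorem networkA_irredundant (n : ℕ) : (networkA n).Irredundant := irredundant_ofFamily _ _

theorem networkB_irredundant (n : ℕ) : (networkB n).Irredundant := irredundant_ofFamily _ _

theorem networkA_rateBound [Infinite F] (hn : 1 ≤ n) (hF : (n : F) ≠ 0) :
    (networkA n).RateBound F ((n + 2 : ℕ) + 1 / (n + 2 : ℕ)) := by
  refine rateBound_ofFamily _ fun k K hK => ?_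
  have h := (commonDependencies K fun x hx Y hY => hK x hx Y (Or.inl hY)).finrank_le_of_ne_zero
    hn hF fun x i hx => hK x x.2 _ (Or.inr rfl) (B i) ⟨i, rfl⟩ <| by
      rintro _ ⟨j, rfl⟩ hu
      exact hx j fun h => hu (h ▸ rfl)
  -- With `2 n + 3` sources, `dim K ≤ (n + 1 - 1 / (n + 2)) k` leaves `(n + 2 + 1 / (n + 2)) k` for
  -- the broadcast.
  have h' : ((n : ℝ) + 2) * finrank F K + k ≤ (n + 2) * ((n + 1) * k) := by exact_mod_cast h
  have hpos : (0 : ℝ) < (n : ℝ) + 2 := by positivity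
  rw [Ground.card_eq]
  push_cast
  rw [← mul_le_mul_iff_right₀ hpos]
  field_simp
  linarith

theorem networkB_rateBound [Infinite F] (hn : 1 ≤ n) (hF : (n : F) = 0) :
    (networkB n).RateBound F ((n + 2 : ℕ) + 1 / (n + 3 : ℕ)) := by
  refine rateBound_ofFamily _ fun k K hK => ?_
  have h := (commonDependencies K fun x hx Y hY => hK x hx Y (Or.inl hY)).finrank_le_of_eq_zero
    hn hF fun x hx => hK x x.2 _ (Or.inr rfl) C (Or.inr rfl) <| by
      rintro _ (⟨j, rfl⟩ | rfl) hu
      exacts [hx j, absurd rfl hu]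
  have h' : ((n : ℝ) + 3) * finrank F K + k ≤ (n + 3) * ((n + 1) * k) := by exact_mod_cast h
  have hpos : (0 : ℝ) < (n : ℝ) + 3 := by positivity
  rw [Ground.card_eq]
  push_cast
  rw [← mul_le_mul_iff_right₀ hpos]
  field_simp
  linarith

theorem networkA_hasMatrixCode (hF : (n : F) = 0) :
    (networkA n).HasMatrixCode F (Fin 1) (Fin (n + 2)) := by
  refine (hasMatrixCode_ofFamily (parityCheck n F) fun Y hY => ?_).reindex (Equiv.refl _)
    (Fintype.equivFinOfCardEq (by simp)).symm
  rcases hY with hY | rfl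
  · exact exists_vecMul_parityCheck Y hY
  · refine ⟨Sum.elim 1 fun _ => -(n : F), fun s => ?_⟩
    rw [vecMul_parityCheck_one_neg]
    cases s <;> simp [hF]

theorem networkB_hasMatrixCode (hF : (n : F) ≠ 0) :
    (networkB n).HasMatrixCode F (Fin 1) (Fin (n + 2)) := by
  refine (hasMatrixCode_ofFamily (parityCheck n F) fun Y hY => ?_).reindex (Equiv.refl _)
    (Fintype.equivFinOfCardEq (by simp)).symm
  rcases hY with hY | rfl
  · exact exists_vecMul_parityCheck Y hY
  · refine ⟨Sum.elim 1 fun _ => -(n : F), fun s => ?_⟩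
    rw [vecMul_parityCheck_one_neg]
    cases s <;> simp [hF]

theorem networkA_hasMatrixCode_large (n : ℕ) (F : Type u) [Field F] :
    (networkA n).HasMatrixCode F (Fin 1) (Fin (n + 3)) :=
  (hasMatrixCode_ofFamily (largeParityCheck n F) fun Y hY =>
    exists_vecMul_largeParityCheck Y (Or.inl hY)).reindex (Equiv.refl _)
    (Fintype.equivFinOfCardEq (by simp)).symm

theorem networkB_hasMatrixCode_large (n : ℕ) (F : Type u) [Field F] :
    (networkB n).HasMatrixCode F (Fin 1) (Fin (n + 3)) :=
  (hasMatrixCode_ofFamily (largeParityCheck n F) fun Y hY =>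
    exists_vecMul_largeParityCheck Y (Or.inr hY)).reindex (Equiv.refl _)
    (Fintype.equivFinOfCardEq (by simp)).symm

end Networks

theorem mainTheorem3 (n k : ℕ) (hn : 2 ≤ n) (hk : 1 ≤ k) (F : Type*) [Field F] :
    ((((networkA n).lexPow k).block ((n + 2) ^ k)).LinearlySolvable F ↔ ringChar F ∣ n) ∧
    (¬ ringChar F ∣ n →
      (((n : ℝ≥0∞) + 2) / ((n : ℝ≥0∞) + 3)) ^ k ≤
        (((networkA n).lexPow k).block ((n + 2) ^ k)).linearCapacity F ∧
      (((networkA n).lexPow k).block ((n + 2) ^ k)).linearCapacity F ≤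
        ((5 * (n : ℝ≥0∞) ^ 3 + 22 * (n : ℝ≥0∞) ^ 2 + 31 * (n : ℝ≥0∞) + 14) /
          (5 * (n : ℝ≥0∞) ^ 3 + 22 * (n : ℝ≥0∞) ^ 2 + 31 * (n : ℝ≥0∞) + 15)) ^ k) ∧
    ((((networkB n).lexPow k).block ((n + 2) ^ k)).LinearlySolvable F ↔ ¬ ringChar F ∣ n) ∧
    (ringChar F ∣ n →
      (((n : ℝ≥0∞) + 2) / ((n : ℝ≥0∞) + 3)) ^ k ≤
        (((networkB n).lexPow k).block ((n + 2) ^ k)).linearCapacity F ∧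
      (((networkB n).lexPow k).block ((n + 2) ^ k)).linearCapacity F ≤
        (((n : ℝ≥0∞) ^ 3 + 8 * (n : ℝ≥0∞) ^ 2 + 19 * (n : ℝ≥0∞) + 14) /
          ((n : ℝ≥0∞) ^ 3 + 8 * (n : ℝ≥0∞) ^ 2 + 19 * (n : ℝ≥0∞) + 15)) ^ k) := by
  obtain ⟨j, rfl⟩ : ∃ j, k = j + 1 := ⟨k - 1, by omega⟩
  -- Divisibility by the characteristic becomes `(n : F) = 0`, which is insensitive to field
  -- extension.
  rw [← ringChar.spec]
  let φ := algebraMap F (AlgebraicClosure F)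
  have hφ : (n : AlgebraicClosure F) = 0 ↔ (n : F) = 0 := by
    rw [← map_natCast φ, map_eq_zero]
  have hn1 : 1 ≤ n := by omega
  have hA := networkA_irredundant n
  have hB := networkB_irredundant n
  refine ⟨⟨fun h => ?_, fun h => (networkA_hasMatrixCode h).linearlySolvable_lexPow hA j⟩,
    fun h => ⟨?_, ?_⟩,
    ⟨fun h h0 => ?_, fun h => (networkB_hasMatrixCode h).linearlySolvable_lexPow hB j⟩,
    fun h => ⟨?_, ?_⟩⟩
  · by_contra h0
    exact (networkA_rateBound hn1 (mt hφ.1 h0)).not_linearlySolvable_lexPow φ hA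
      (by omega) (by omega) j h
  · exact_mod_cast (networkA_hasMatrixCode_large n F).le_linearCapacity_lexPow hA
      (m := n + 2) (by omega) (by omega) j
  -- Here `m q = (n + 2) ^ 2`, well below the stated polynomial.
  · have := (networkA_rateBound hn1 (mt hφ.1 h)).linearCapacity_lexPow_le φ hA
      (P := 5 * n ^ 3 + 22 * n ^ 2 + 31 * n + 14) (by omega) (by omega) (by nlinarith) j
    exact_mod_cast this
  · exact (networkB_rateBound hn1 (hφ.2 h0)).not_linearlySolvable_lexPow φ hB
      (by omega) (by omega) j h
  · exact_mod_cast (networkB_hasMatrixCode_large n F).le_linearCapacity_lexPow hB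
      (m := n + 2) (by omega) (by omega) j
  -- Here `m q = (n + 2) (n + 3)`.
  · have := (networkB_rateBound hn1 (hφ.2 h)).linearCapacity_lexPow_le φ hB
      (P := n ^ 3 + 8 * n ^ 2 + 19 * n + 14) (by omega) (by omega) (by nlinarith) j
    exact_mod_cast this
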